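/- Fix real numbers $k_1\ge k_0\ge 0$. All function spaces are real. For $q\in L_1[0,1]$ let $\lambda_1(q)$ be the minimal eigenvalue of the problem $$-y''+(q-\lambda)y=0\ \text{ a.e. on }[0,1],\qquad y'(0)-k_0^2y(0)=0,\quad y'(1)+k_1^2y(1)=0,$$ with solutions $y\in W_1^2[0,1]$. Let $A_1=\{q\in L_1[0,1]: q\ge 0\text{ a.e.},\ \int_0^1q\,dx=1\}$ and $m_1^+=\inf_{q\in A_1}\lambda_1(q)$. Let $W_2^{-1}[0,1]$ be the completion of $L_2[0,1]$ in the norm $\|f\|=\sup_{\|z\|_{W_2^1[0,1]}=1}\int_0^1fz\,dx$ (that is, the dual space of $W_2^1[0,1]$, where $f$ acts by $\langle f,z\rangle=\int_0^1 fz\,dx$), and let $\Gamma_1$ be the closure of $A_1$ in $W_2^{-1}[0,1]$. For $q\in W_2^{-1}[0,1]$ let $\lambda_1(q)$ be the minimal $\lambda\in\mathbb R$ for which there is a non-zero $y\in W_2^1[0,1]$ such that $$\int_0^1\left[y'z'-\lambda yz\right]dx+\langle q,yz\rangle+k_0^2y(0)z(0)+k_1^2y(1)z(1)=0\qquad\text{for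 all }z\in W_2^1[0,1]$$ (for $q\in L_1[0,1]$ this agrees with the definition above). Then $m_1^+$ is the minimal eigenvalue of the problem $$-y''=\lambda y,\qquad y'(0)-k_0^2y(0)=y'(1)+(k_1^2+1)y(1)=0,$$ and it is attained at the potential $\boldsymbol\delta_1$, the Dirac function with support at the point $1$: one has $\boldsymbol\delta_1\in\Gamma_1$ and $m_1^+=\lambda_1(\boldsymbol\delta_1)=\min_{q\in\Gamma_1}\lambda_1(q)$. -/

import Mathlib

open Set MeasureTheory

namespace SturmLiouville

/-- Lebesgue measure on `[0,1]`. -/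
noncomputable abbrev leb : Measure ℝ := volume.restrict (Icc (0 : ℝ) 1)

/-- A continuous function on `[0,1]`, extended by constants to the real line so that integrals and
derivatives over `[0,1]` can be written with Mathlib's operations on functions `ℝ → ℝ`. -/
noncomputable abbrev ext (y : C(Icc (0 : ℝ) 1, ℝ)) : ℝ → ℝ := IccExtend zero_le_one y

/-! ### The classical boundary value problem -/

/-- Membership in the Sobolev space `W_1^2[0,1]`: `y` is continuously differentiable on `[0,1]`
(one-sidedly at the end points) and `y'` is absolutely continuous on `[0,1]`. -/
def MemW12 (y : ℝ → ℝ) : Prop :=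
  ContDiffOn ℝ 1 y (Icc 0 1) ∧ AbsolutelyContinuousOnInterval (derivWithin y (Icc 0 1)) 0 1

/-- `lam` is an eigenvalue of the problem `-y'' + (q - lam) y = 0` almost everywhere on `[0,1]`,
`y'(0) - a y(0) = 0`, `y'(1) + b y(1) = 0`, with solutions in `W_1^2[0,1]`. -/
def IsEigenvalue (q : ℝ → ℝ) (a b lam : ℝ) : Prop :=
  ∃ y : ℝ → ℝ, MemW12 y ∧ (∃ x ∈ Icc (0 : ℝ) 1, y x ≠ 0) ∧
    (∀ᵐ x ∂leb,
      -derivWithin (derivWithin y (Icc 0 1)) (Icc 0 1) x + (q x - lam) * y x = 0) ∧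
    derivWithin y (Icc 0 1) 0 - a * y 0 = 0 ∧
    derivWithin y (Icc 0 1) 1 + b * y 1 = 0

/-- `lam = λ₁(q)` is the minimal eigenvalue of the classical problem. -/
def IsMinEigenvalue (q : ℝ → ℝ) (a b lam : ℝ) : Prop :=
  IsLeast {l : ℝ | IsEigenvalue q a b l} lam

/-- The set `A_1` of the potentials `q ∈ L_1[0,1]` with `q ≥ 0` almost everywhere, `∫ q = 1`. -/
def A1 : Set (Lp ℝ 1 leb) := {q | (∀ᵐ x ∂leb, 0 ≤ q x) ∧ ∫ x in (0 : ℝ)..1, q x = 1}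

/-- The set `Λ(A_1)` of the values `λ₁(q)`, `q ∈ A_1`, for the boundary conditions
`y'(0) - k₀² y(0) = y'(1) + k₁² y(1) = 0`. -/
def LambdaA1 (k₀ k₁ : ℝ) : Set ℝ :=
  {lam | ∃ q ∈ A1, IsMinEigenvalue q (k₀ ^ 2) (k₁ ^ 2) lam}

/-- `m_1^+ = inf_{q ∈ A_1} λ₁(q)`. -/
noncomputable def m1Plus (k₀ k₁ : ℝ) : ℝ := sInf (LambdaA1 k₀ k₁)

/-! ### The space `W_2^1[0,1]` -/

lemma continuous_ext (y : C(Icc (0 : ℝ) 1, ℝ)) : Continuous (ext y) := y.continuous.Icc_extend'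

lemma abs_ext_le (y : C(Icc (0 : ℝ) 1, ℝ)) (x : ℝ) : |ext y x| ≤ ‖y‖ :=
  y.norm_coe_le_norm _

lemma memLp_ext (y : C(Icc (0 : ℝ) 1, ℝ)) : MemLp (ext y) 2 leb :=
  MemLp.of_bound (continuous_ext y).aestronglyMeasurable ‖y‖
    (Filter.Eventually.of_forall fun x => abs_ext_le y x)

lemma ae_diff {f : ℝ → ℝ} (hf : AbsolutelyContinuousOnInterval f 0 1) :
    ∀ᵐ x ∂leb, DifferentiableAt ℝ f x := by
  rw [ae_restrict_iff' measurableSet_Icc]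
  filter_upwards [hf.ae_differentiableAt] with x hx hm
  exact hx (by rwa [uIcc_of_le zero_le_one])

lemma deriv_ext_add {y z : C(Icc (0 : ℝ) 1, ℝ)} (hy : AbsolutelyContinuousOnInterval (ext y) 0 1)
    (hz : AbsolutelyContinuousOnInterval (ext z) 0 1) :
    deriv (ext (y + z)) =ᵐ[leb] deriv (ext y) + deriv (ext z) := by
  filter_upwards [ae_diff hy, ae_diff hz] with x h1 h2
  exact deriv_add h1 h2

lemma deriv_ext_smul (c : ℝ) {y : C(Icc (0 : ℝ) 1, ℝ)}
    (hy : AbsolutelyContinuousOnInterval (ext y) 0 1) :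
    deriv (ext (c • y)) =ᵐ[leb] c • deriv (ext y) := by
  filter_upwards [ae_diff hy] with x h1
  exact deriv_const_smul c h1

lemma deriv_ext_mul {y z : C(Icc (0 : ℝ) 1, ℝ)} (hy : AbsolutelyContinuousOnInterval (ext y) 0 1)
    (hz : AbsolutelyContinuousOnInterval (ext z) 0 1) :
    deriv (ext (y * z)) =ᵐ[leb] deriv (ext y) * ext z + ext y * deriv (ext z) := by
  filter_upwards [ae_diff hy, ae_diff hz] with x h1 h2
  exact deriv_mul h1 h2

/-- The functions in `W_2^1[0,1]`: absolutely continuous on `[0,1]` with derivative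
in `L_2[0,1]`. -/
def sobolev : Submodule ℝ C(Icc (0 : ℝ) 1, ℝ) where
  carrier := {y | AbsolutelyContinuousOnInterval (ext y) 0 1 ∧ MemLp (deriv (ext y)) 2 leb}
  add_mem' := fun {y z} hy hz =>
    ⟨hy.1.add hz.1, (memLp_congr_ae (deriv_ext_add hy.1 hz.1)).2 (hy.2.add hz.2)⟩
  zero_mem' := by
    have h : ext (0 : C(Icc (0 : ℝ) 1, ℝ)) = fun _ => (0 : ℝ) := rfl
    refine ⟨?_, ?_⟩
    · rw [h]
      exact (LipschitzOnWith.of_dist_le_mul (K := 0)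
        (fun x _ y _ => by simp)).absolutelyContinuousOnInterval
    · rw [h]
      simp
  smul_mem' := fun c y hy =>
    ⟨hy.1.const_smul c, (memLp_congr_ae (deriv_ext_smul c hy.1)).2 (hy.2.const_smul c)⟩

lemma mul_mem_sobolev {y z : C(Icc (0 : ℝ) 1, ℝ)} (hy : y ∈ sobolev) (hz : z ∈ sobolev) :
    y * z ∈ sobolev := by
  refine ⟨hy.1.mul hz.1, (memLp_congr_ae (deriv_ext_mul hy.1 hz.1)).2 (MemLp.add ?_ ?_)⟩
  · have h := MemLp.of_bound (p := ⊤) (μ := leb) (continuous_ext z).aestronglyMeasurable ‖z‖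
      (Filter.Eventually.of_forall fun x => abs_ext_le z x)
    exact h.mul hy.2
  · have h := MemLp.of_bound (p := ⊤) (μ := leb) (continuous_ext y).aestronglyMeasurable ‖y‖
      (Filter.Eventually.of_forall fun x => abs_ext_le y x)
    exact hz.2.mul h

/-- The Sobolev space `W_2^1[0,1]` of real functions. It is a type of its own, since it carries the
Sobolev norm and not the norm of `C[0,1]`. -/
def W21 : Type := sobolev

namespace W21

noncomputable instance : AddCommGroup W21 := inferInstanceAs (AddCommGroup sobolev)

noncomputable instance : Module ℝ W21 := inferInstanceAs (Module ℝ sobolev)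

/-- The underlying continuous function on `[0,1]`. -/
def toC (y : W21) : C(Icc (0 : ℝ) 1, ℝ) := y.1

/-- The values of `y`, as a function on the real line (of interest on `[0,1]`). -/
noncomputable def fn (y : W21) : ℝ → ℝ := ext y.toC

/-- The product of two functions in `W_2^1[0,1]`. -/
noncomputable instance : Mul W21 := ⟨fun y z => ⟨y.1 * z.1, mul_mem_sobolev y.2 z.2⟩⟩

lemma ac (y : W21) : AbsolutelyContinuousOnInterval y.fn 0 1 := y.2.1

lemma memLp_fn (y : W21) : MemLp y.fn 2 leb := memLp_ext y.1

lemma memLp_deriv (y : W21) : MemLp (deriv y.fn) 2 leb := y.2.2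

lemma fn_add (y z : W21) : (y + z).fn = y.fn + z.fn := rfl

lemma fn_smul (c : ℝ) (y : W21) : (c • y).fn = c • y.fn := rfl

lemma fn_mul (y z : W21) : (y * z).fn = y.fn * z.fn := rfl

/-- The map `y ↦ (y, y')` into `L_2 × L_2` with the Hilbert norm. -/
noncomputable def graph : W21 →ₗ[ℝ] WithLp 2 (Lp ℝ 2 leb × Lp ℝ 2 leb) where
  toFun y := WithLp.toLp 2 (y.memLp_fn.toLp y.fn, y.memLp_deriv.toLp (deriv y.fn))
  map_add' y z := by
    have h1 : (y + z).memLp_fn.toLp (y + z).fn = y.memLp_fn.toLp y.fn + z.memLp_fn.toLp z.fn :=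
      rfl
    have h2 : (y + z).memLp_deriv.toLp (deriv (y + z).fn)
        = y.memLp_deriv.toLp (deriv y.fn) + z.memLp_deriv.toLp (deriv z.fn) := by
      rw [← MemLp.toLp_add]
      exact (MemLp.toLp_eq_toLp_iff _ _).2 (deriv_ext_add y.ac z.ac)
    rw [h1, h2]
    rfl
  map_smul' c y := by
    have h1 : (c • y).memLp_fn.toLp (c • y).fn = c • y.memLp_fn.toLp y.fn := rfl
    have h2 : (c • y).memLp_deriv.toLp (deriv (c • y).fn)
        = c • y.memLp_deriv.toLp (deriv y.fn) := by
      rw [← MemLp.toLp_const_smul]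
      exact (MemLp.toLp_eq_toLp_iff _ _).2 (deriv_ext_smul c y.ac)
    rw [h1, h2]
    rfl

lemma graph_injective : Function.Injective graph := by
  rw [← LinearMap.ker_eq_bot, LinearMap.ker_eq_bot']
  intro y hy
  have h1 : y.memLp_fn.toLp y.fn = 0 := congrArg (fun p => (WithLp.ofLp p).1) hy
  have h2 : y.fn =ᵐ[leb] 0 := by
    have := y.memLp_fn.coeFn_toLp
    rw [h1] at this
    exact this.symm.trans (Lp.coeFn_zero ℝ 2 leb)
  have h3 : EqOn y.fn 0 (Icc 0 1) :=
    Measure.eqOn_Icc_of_ae_eq volume zero_ne_one h2 (continuous_ext y.1).continuousOn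
      continuousOn_const
  apply Subtype.ext
  ext x
  have h4 := h3 x.2
  simp only [fn, toC, ext, IccExtend_val] at h4
  exact h4

/-- The Sobolev norm, the square root of `∫ y² + ∫ y'²`. -/
noncomputable instance : NormedAddCommGroup W21 :=
  NormedAddCommGroup.induced W21 (WithLp 2 (Lp ℝ 2 leb × Lp ℝ 2 leb)) graph graph_injective

noncomputable instance : NormedSpace ℝ W21 :=
  NormedSpace.induced ℝ W21 (WithLp 2 (Lp ℝ 2 leb × Lp ℝ 2 leb)) graph

lemma norm_sq (y : W21) :
    ‖y‖ ^ 2 = ∫ x in (0 : ℝ)..1, (y.fn x ^ 2 + deriv y.fn x ^ 2) := by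
  have key : ∀ {f : ℝ → ℝ} (hf : MemLp f 2 leb), ‖hf.toLp f‖ ^ 2 = ∫ x, f x ^ 2 ∂leb := by
    intro f hf
    rw [← real_inner_self_eq_norm_sq, L2.inner_def]
    refine integral_congr_ae ?_
    filter_upwards [hf.coeFn_toLp] with x hx
    simp [hx, sq]
  have h : ‖y‖ = ‖graph y‖ := rfl
  rw [h, WithLp.prod_norm_sq_eq_of_L2, intervalIntegral.integral_of_le zero_le_one,
    ← integral_Icc_eq_integral_Ioc,
    integral_add y.memLp_fn.integrable_sq y.memLp_deriv.integrable_sq]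
  exact congrArg₂ (· + ·) (key y.memLp_fn) (key y.memLp_deriv)

/-- The Sobolev embedding into `C[0,1]`. -/
lemma abs_fn_le (y : W21) (x : ℝ) : |y.fn x| ≤ 2 * ‖y‖ := by
  rcases eq_or_ne y 0 with rfl | hy
  · have h : (0 : W21).fn x = 0 := rfl
    simp [h]
  have hN : 0 < ‖y‖ := norm_pos_iff.2 hy
  have hg : IntervalIntegrable (fun t => y.fn t ^ 2 + deriv y.fn t ^ 2) volume 0 1 := by
    rw [intervalIntegrable_iff_integrableOn_Icc_of_le zero_le_one]
    exact y.memLp_fn.integrable_sq.add y.memLp_deriv.integrable_sq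
  have hd : IntervalIntegrable (deriv y.fn) volume 0 1 := y.ac.intervalIntegrable_deriv
  obtain ⟨s, hs, hxs⟩ : ∃ s ∈ Icc (0 : ℝ) 1, y.fn x = y.fn s :=
    ⟨projIcc 0 1 zero_le_one x, (projIcc 0 1 zero_le_one x).2, by
      simp [fn, ext, IccExtend, projIcc_val]⟩
  have hpt : ∀ t ∈ Icc (0 : ℝ) 1,
      |y.fn s| ≤ |y.fn t| + ∫ r in (0 : ℝ)..1, |deriv y.fn r| := by
    intro t ht
    have h1 : uIcc t s ⊆ uIcc (0 : ℝ) 1 := by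
      rw [uIcc_of_le zero_le_one]
      exact uIcc_subset_Icc ht hs
    have h2 : ∫ r in t..s, deriv y.fn r = y.fn s - y.fn t := (y.ac.mono h1).integral_deriv_eq_sub
    have h3 : |∫ r in t..s, deriv y.fn r| ≤ ∫ r in (0 : ℝ)..1, |deriv y.fn r| := by
      refine (intervalIntegral.norm_integral_le_abs_integral_norm (f := deriv y.fn)).trans ?_
      refine (intervalIntegral.abs_integral_mono_interval ?_
        (Filter.Eventually.of_forall fun r => abs_nonneg _) hd.abs).trans (le_of_eq ?_)
      · rw [uIoc_of_le zero_le_one, uIoc_eq_union]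
        exact union_subset (Ioc_subset_Ioc ht.1 hs.2) (Ioc_subset_Ioc hs.1 ht.2)
      · exact abs_of_nonneg (intervalIntegral.integral_nonneg zero_le_one fun r _ => abs_nonneg _)
    have h4 : y.fn s = y.fn t + (y.fn s - y.fn t) := by ring
    calc |y.fn s| = |y.fn t + (y.fn s - y.fn t)| := by rw [← h4]
      _ ≤ |y.fn t| + |y.fn s - y.fn t| := abs_add_le _ _
      _ ≤ _ := by rw [← h2]; gcongr
  have hfi : IntervalIntegrable (fun t => |y.fn t|) volume 0 1 :=
    ((continuous_ext y.1).abs).intervalIntegrable 0 1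
  have hint : |y.fn s| ≤ (∫ t in (0 : ℝ)..1, |y.fn t|) + ∫ r in (0 : ℝ)..1, |deriv y.fn r| := by
    have h := intervalIntegral.integral_mono_on zero_le_one
      (intervalIntegrable_const (c := |y.fn s|) (μ := volume))
      (hfi.add (intervalIntegrable_const (c := ∫ r in (0 : ℝ)..1, |deriv y.fn r|))) hpt
    rw [intervalIntegral.integral_add hfi intervalIntegrable_const] at h
    simpa using h
  have hsum : (∫ t in (0 : ℝ)..1, |y.fn t|) + ∫ r in (0 : ℝ)..1, |deriv y.fn r|
      ≤ (2 * ‖y‖)⁻¹ * ‖y‖ ^ 2 + ‖y‖ := by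
    rw [← intervalIntegral.integral_add hfi hd.abs, norm_sq y,
      ← intervalIntegral.integral_const_mul]
    have hc : ∫ _ in (0 : ℝ)..1, ‖y‖ = ‖y‖ := by simp
    conv_rhs => rw [← hc]
    rw [← intervalIntegral.integral_add (hg.const_mul _) intervalIntegrable_const]
    refine intervalIntegral.integral_mono_on zero_le_one (hfi.add hd.abs)
      ((hg.const_mul _).add intervalIntegrable_const) fun t _ => ?_
    rw [hc, inv_mul_eq_div, div_add' _ _ _ (by positivity), le_div_iff₀ (by positivity),
      ← sq_abs (y.fn t), ← sq_abs (deriv y.fn t)]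
    nlinarith [sq_nonneg (|y.fn t| - ‖y‖), sq_nonneg (|deriv y.fn t| - ‖y‖)]
  have hfin : (2 * ‖y‖)⁻¹ * ‖y‖ ^ 2 + ‖y‖ = 3 / 2 * ‖y‖ := by
    field_simp
    ring
  rw [hxs]
  linarith

end W21

/-! ### The space `W_2^{-1}[0,1]` and the generalized problem -/

/-- The space `W_2^{-1}[0,1]`: the dual space of `W_2^1[0,1]` with the operator norm. The function
`f ∈ L_2[0,1]` acts by `z ↦ ∫ f z`, and the dual space is the completion of `L_2[0,1]` in this
norm. -/
abbrev Wm1 : Type := StrongDual ℝ W21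

/-- The Dirac function with support at `x`: `⟨δ_x, z⟩ = z(x)`. -/
noncomputable def delta (x : Icc (0 : ℝ) 1) : Wm1 :=
  LinearMap.mkContinuous
    { toFun := fun z => z.fn x
      map_add' := fun _ _ => rfl
      map_smul' := fun _ _ => rfl } 2 (fun z => z.abs_fn_le x)

lemma integrable_mul_fn (q : Lp ℝ 1 leb) (z : W21) : Integrable (fun x => q x * z.fn x) leb :=
  (L1.integrable_coeFn q).mul_bdd (c := 2 * ‖z‖) (continuous_ext z.1).aestronglyMeasurable
    (Filter.Eventually.of_forall fun x => z.abs_fn_le x)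

/-- The summable potential `q` as an element of `W_2^{-1}[0,1]`: `⟨q, z⟩ = ∫ q z`. -/
noncomputable def ofL1 (q : Lp ℝ 1 leb) : Wm1 :=
  LinearMap.mkContinuous
    { toFun := fun z => ∫ x, q x * z.fn x ∂leb
      map_add' := fun y z => by
        rw [← integral_add (integrable_mul_fn q y) (integrable_mul_fn q z)]
        exact integral_congr_ae (Filter.Eventually.of_forall fun x => mul_add _ _ _)
      map_smul' := fun c z => by
        rw [RingHom.id_apply, smul_eq_mul, ← integral_const_mul]
        exact integral_congr_ae (Filter.Eventually.of_forall fun x => mul_left_comm _ _ _) }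
    (2 * ‖q‖) (fun z => by
      have h : ‖q‖ = ∫ x, ‖q x‖ ∂leb := L1.norm_eq_integral_norm q
      rw [h, mul_right_comm, ← integral_const_mul]
      refine norm_integral_le_of_norm_le ((L1.integrable_coeFn q).norm.const_mul _)
        (Filter.Eventually.of_forall fun x => ?_)
      rw [norm_mul, mul_comm]
      exact mul_le_mul_of_nonneg_right (z.abs_fn_le x) (norm_nonneg _))

/-- The form `⟨T_q(lam) y, z⟩` of the operator pencil of the problem `-y'' + (q - lam) y = 0`,
`y'(0) - a y(0) = y'(1) + b y(1) = 0` with a potential `q ∈ W_2^{-1}[0,1]`. -/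
noncomputable def pencil (q : Wm1) (a b lam : ℝ) (y z : W21) : ℝ :=
  (∫ x in (0 : ℝ)..1, deriv y.fn x * deriv z.fn x) +
    (q (y * z) - lam * ∫ x in (0 : ℝ)..1, y.fn x * z.fn x) +
    a * y.fn 0 * z.fn 0 + b * y.fn 1 * z.fn 1

/-- `lam` is an eigenvalue of the pencil `T_q`: the kernel of `T_q(lam)` is non-trivial. -/
def IsPencilEigenvalue (q : Wm1) (a b lam : ℝ) : Prop :=
  ∃ y : W21, y ≠ 0 ∧ ∀ z : W21, pencil q a b lam y z = 0

/-- `lam = λ₁(q)` is the minimal eigenvalue of the pencil `T_q`. -/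
def IsMinPencilEigenvalue (q : Wm1) (a b lam : ℝ) : Prop :=
  IsLeast {l : ℝ | IsPencilEigenvalue q a b l} lam

/-- The extended class of potentials `Γ_1`: the closure of `A_1` in `W_2^{-1}[0,1]`. -/
def Gamma1 : Set Wm1 := closure (ofL1 '' A1)

/-- The set `Λ(Γ_1)` of the values `λ₁(q)`, `q ∈ Γ_1`, for the boundary conditions
`y'(0) - k₀² y(0) = y'(1) + k₁² y(1) = 0`. -/
def LambdaGamma1 (k₀ k₁ : ℝ) : Set ℝ :=
  {lam | ∃ q ∈ Gamma1, IsMinPencilEigenvalue q (k₀ ^ 2) (k₁ ^ 2) lam}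

end SturmLiouville

/-! Write `a = k₀²` and `b = k₁²`. The potential `δ_1` contributes `y(1)²` to the energy form, so its
least eigenvalue is that of `-y'' = lam y` with `b` replaced by `b + 1`. This eigenvalue is `ω²` with
`arctan (a / ω) + arctan ((b + 1) / ω) = ω`. Positive eigenfunctions are handled through their
logarithmic derivatives `w`, the solutions of the Riccati equation `w' = q - lam - w²`: such a `w`
gives an eigenfunction `exp (∫ w)` (`IsRiccati.isEigenvalue`) and, by `y'² ≥ 2 w y y' - w² y²`, a lower
bound for the energy (`IsRiccati.le_energy`), hence the least eigenvalue.

No potential does better than `δ_1`. For a point `c`, let `w₁`, `w₂` be the solutions of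
`w' = -ω² - w²` with `w₁(0) = a` and `w₂(1) = -b`. The energy bound on `[0, c]` with `w₁` and on
`[c, 1]` with `w₂` shows that the form of `δ_c` is at least `ω² ∫ y²` as soon as `w₂(c) - w₁(c) ≤ 1`.
This difference is explicit; its value at `c = 1` is `1`, and `k₀ ≤ k₁` ensures that this is its
maximum (`tan_sub_tan_le`, `frequency_sq_le`). For `q ∈ A_1` the bounds for `δ_c` are averaged over `c`
with weight `q`, and the result extends to the closure `Γ_1` (`le_form_of_mem_Gamma1`).

That `ω²` is not only a lower bound for the values `λ₁(q)`, `q ∈ A_1`, but their infimum, follows from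
explicit potentials with `λ₁(q) = ν²` for `ν > ω` arbitrarily close to `ω` (`exists_frequency_lt`).
They are found by prescribing `w` and setting `q = w' + ν² + w²`; the condition `∫ q = 1` is met by the
intermediate value theorem. Finally, `δ_1` is the limit of normalized indicator functions of small
intervals at `1` (`delta_one_mem_Gamma1`). -/

open Set MeasureTheory

namespace SturmLiouville

/-! ### Riccati equations and energy estimates -/

lemma integral_leb (f : ℝ → ℝ) : ∫ x, f x ∂leb = ∫ x in (0 : ℝ)..1, f x := by
  rw [intervalIntegral.integral_of_le zero_le_one, ← integral_Icc_eq_integral_Ioc]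

lemma intervalIntegrable_of_leb {f : ℝ → ℝ} (hf : Integrable f leb) {c d : ℝ} (hc : 0 ≤ c)
    (hcd : c ≤ d) (hd : d ≤ 1) : IntervalIntegrable f volume c d := by
  rw [intervalIntegrable_iff_integrableOn_Icc_of_le hcd]
  exact IntegrableOn.mono_set hf (Icc_subset_Icc hc hd)

lemma ae_leb_iff {p : ℝ → Prop} : (∀ᵐ x ∂leb, p x) ↔ ∀ᵐ x, x ∈ Ioo (0 : ℝ) 1 → p x := by
  rw [leb, ← Measure.restrict_congr_set Ioo_ae_eq_Icc, ae_restrict_iff' measurableSet_Ioo]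

lemma W21.continuous_fn (y : W21) : Continuous y.fn := continuous_ext y.1

/-- `w` is a solution of the Riccati equation `w' = q - lam - w²` on `[c, d]`, that is, the
logarithmic derivative of a positive solution of `-y'' + (q - lam) y = 0`. As `q` is only integrable,
`w` is absolutely continuous and the equation holds almost everywhere. -/
def IsRiccati (q : ℝ → ℝ) (lam c d : ℝ) (w : ℝ → ℝ) : Prop :=
  AbsolutelyContinuousOnInterval w c d ∧
    ∀ᵐ x, x ∈ Ioo c d → HasDerivAt w (q x - lam - w x ^ 2) x

/-- Picone's inequality: the derivative of `w y²` is at most `y'² + (q - lam) y²`, because the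
difference is `(y' - w y)²`. Integrate over `[c, d]`. -/
lemma IsRiccati.le_energy {q w : ℝ → ℝ} {lam c d : ℝ} (h : IsRiccati q lam c d w)
    (hq : Integrable q leb) (hc : 0 ≤ c) (hcd : c ≤ d) (hd : d ≤ 1) (y : W21) :
    lam * (∫ x in c..d, y.fn x ^ 2) + (w d * y.fn d ^ 2 - w c * y.fn c ^ 2)
      ≤ (∫ x in c..d, deriv y.fn x ^ 2) + ∫ x in c..d, q x * y.fn x ^ 2 := by
  have hy : AbsolutelyContinuousOnInterval y.fn c d := by
    refine y.ac.mono ?_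
    rw [uIcc_of_le hcd, uIcc_of_le zero_le_one]
    exact Icc_subset_Icc hc hd
  have hp := h.1.mul (hy.mul hy)
  have hi1 : IntervalIntegrable (fun x => lam * y.fn x ^ 2) volume c d :=
    ((y.continuous_fn.pow 2).const_mul lam).intervalIntegrable c d
  have hi2 : IntervalIntegrable (fun x => deriv y.fn x ^ 2) volume c d :=
    intervalIntegrable_of_leb y.memLp_deriv.integrable_sq hc hcd hd
  have hi3 : IntervalIntegrable (fun x => q x * y.fn x ^ 2) volume c d :=
    (intervalIntegrable_of_leb hq hc hcd hd).mul_continuousOn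
      (y.continuous_fn.pow 2).continuousOn
  have hftc := hp.integral_deriv_eq_sub
  have hle : ∫ x in c..d, (lam * y.fn x ^ 2 + deriv (w * (y.fn * y.fn)) x)
      ≤ ∫ x in c..d, (deriv y.fn x ^ 2 + q x * y.fn x ^ 2) := by
    refine intervalIntegral.integral_mono_ae_restrict hcd (hi1.add hp.intervalIntegrable_deriv)
      (hi2.add hi3) ?_
    rw [Filter.EventuallyLE, ← Measure.restrict_congr_set Ioo_ae_eq_Icc,
      ae_restrict_iff' measurableSet_Ioo]
    filter_upwards [h.2, hy.ae_differentiableAt] with x hx hyx hm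
    have h1 := hx hm
    have h2 := (hyx (by rw [uIcc_of_le hcd]; exact Ioo_subset_Icc_self hm)).hasDerivAt
    have h3 := (h1.mul (h2.mul h2)).deriv
    rw [h3]
    simp only [Pi.mul_apply]
    nlinarith [sq_nonneg (deriv y.fn x - w x * y.fn x)]
  rw [intervalIntegral.integral_add hi1 hp.intervalIntegrable_deriv,
    intervalIntegral.integral_add hi2 hi3, intervalIntegral.integral_const_mul, hftc] at hle
  simp only [Pi.mul_apply] at hle
  linarith

lemma W21.integral_sq_pos {y : W21} (hy : y ≠ 0) : 0 < ∫ x in (0 : ℝ)..1, y.fn x ^ 2 := by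
  obtain ⟨x, hx⟩ : ∃ x : Icc (0 : ℝ) 1, y.fn x ≠ 0 := by
    by_contra! hc
    refine hy (Subtype.ext (ContinuousMap.ext fun x => ?_))
    have h := hc x
    simp only [W21.fn, W21.toC, ext, IccExtend_val] at h
    exact h
  have hcont : ContinuousOn (fun x => y.fn x ^ 2) (Icc 0 1) :=
    (y.continuous_fn.pow 2).continuousOn
  exact intervalIntegral.integral_pos zero_lt_one hcont (fun _ _ => sq_nonneg _)
    ⟨x, x.2, by positivity⟩

/-- A lower bound for the energy form bounds every eigenvalue of the pencil: test the equation
with the eigenfunction itself. -/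
lemma le_of_isPencilEigenvalue {Q : Wm1} {a b lam l : ℝ}
    (h : ∀ y : W21, lam * (∫ x in (0 : ℝ)..1, y.fn x ^ 2) ≤
      (∫ x in (0 : ℝ)..1, deriv y.fn x ^ 2) + Q (y * y) + a * y.fn 0 ^ 2 + b * y.fn 1 ^ 2)
    (hl : IsPencilEigenvalue Q a b l) : lam ≤ l := by
  obtain ⟨y, hy, hyl⟩ := hl
  have h1 := h y
  have h2 := hyl y
  simp only [pencil, ← sq] at h2
  refine le_of_mul_le_mul_right ?_ (W21.integral_sq_pos hy)
  linarith

/-- A `C¹` function on `[0,1]` as an element of `W_2^1[0,1]`.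
Outside `[0,1]` the values of `y` are replaced by constants. -/
lemma W21.exists_of_contDiffOn {y : ℝ → ℝ} (hy : ContDiffOn ℝ 1 y (Icc 0 1)) :
    ∃ Y : W21, EqOn Y.fn y (Icc 0 1) ∧
      ∀ x ∈ Ioo (0 : ℝ) 1, deriv Y.fn x = derivWithin y (Icc 0 1) x := by
  set F : C(Icc (0 : ℝ) 1, ℝ) :=
    ⟨(Icc 0 1).domRestrict y, hy.continuousOn.domRestrict⟩ with hF
  have hE : EqOn (ext F) y (Icc 0 1) := fun x hx => by
    simp only [ext, IccExtend_of_mem _ _ hx, hF]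
    rfl
  have hD : ∀ x ∈ Ioo (0 : ℝ) 1, deriv (ext F) x = derivWithin y (Icc 0 1) x := by
    intro x hx
    have hn : Icc (0 : ℝ) 1 ∈ nhds x := Icc_mem_nhds hx.1 hx.2
    rw [derivWithin_of_mem_nhds hn]
    exact (hE.eventuallyEq_of_mem hn).deriv_eq
  have hcont : ContinuousOn (derivWithin y (Icc 0 1)) (Icc 0 1) :=
    hy.continuousOn_derivWithin (uniqueDiffOn_Icc zero_lt_one) le_rfl
  obtain ⟨C, hC⟩ := isCompact_Icc.exists_bound_of_continuousOn hcont
  have hmem : F ∈ sobolev := by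
    refine ⟨ContDiffOn.absolutelyContinuousOnInterval ?_, ?_⟩
    · rw [uIcc_of_le zero_le_one]
      exact hy.congr hE
    · refine (memLp_congr_ae (ae_leb_iff.2 (Filter.Eventually.of_forall hD))).2 ?_
      exact MemLp.of_bound (hcont.aestronglyMeasurable measurableSet_Icc) C
        ((ae_restrict_iff' measurableSet_Icc).2 (Filter.Eventually.of_forall hC))
  exact ⟨⟨F, hmem⟩, hE, hD⟩

/-- A classical eigenfunction satisfies the weak equation, by integration by parts. -/
lemma IsEigenvalue.isPencilEigenvalue {q : ℝ → ℝ} {Q : Wm1} {a b l : ℝ} (hq : Integrable q leb)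
    (hQ : ∀ z : W21, Q z = ∫ x in (0 : ℝ)..1, q x * z.fn x) (h : IsEigenvalue q a b l) :
    IsPencilEigenvalue Q a b l := by
  obtain ⟨y, ⟨hy, hac⟩, ⟨x₀, hx₀, hyx₀⟩, heq, hb0, hb1⟩ := h
  obtain ⟨Y, hY, hdY⟩ := W21.exists_of_contDiffOn hy
  refine ⟨Y, ?_, fun z => ?_⟩
  · rintro rfl
    exact hyx₀ (hY hx₀).symm
  set v := derivWithin y (Icc 0 1) with hv
  have hY0 : Y.fn 0 = y 0 := hY (by simp)
  have hY1 : Y.fn 1 = y 1 := hY (by simp)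
  have hparts := hac.integral_mul_deriv_eq_deriv_mul z.ac
  have h1 : ∫ x in (0 : ℝ)..1, deriv Y.fn x * deriv z.fn x
      = ∫ x in (0 : ℝ)..1, v x * deriv z.fn x := by
    rw [← integral_leb, ← integral_leb]
    refine integral_congr_ae (ae_leb_iff.2 (Filter.Eventually.of_forall fun x hx => ?_))
    simp only [hdY x hx]
  have h2 : ∫ x in (0 : ℝ)..1, deriv v x * z.fn x
      = (∫ x in (0 : ℝ)..1, q x * (Y * z).fn x) - l * ∫ x in (0 : ℝ)..1, Y.fn x * z.fn x := by
    rw [← intervalIntegral.integral_const_mul, ← intervalIntegral.integral_sub, ← integral_leb,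
      ← integral_leb]
    · refine integral_congr_ae (ae_leb_iff.2 ?_)
      filter_upwards [ae_leb_iff.1 heq] with x hx hm
      have hn : Icc (0 : ℝ) 1 ∈ nhds x := Icc_mem_nhds hm.1 hm.2
      have hx' := hx hm
      rw [derivWithin_of_mem_nhds hn] at hx'
      have h3 : deriv v x = (q x - l) * y x := by linarith
      simp only [h3, W21.fn_mul, Pi.mul_apply, hY (Ioo_subset_Icc_self hm)]
      ring
    · exact (intervalIntegrable_of_leb hq le_rfl zero_le_one le_rfl).mul_continuousOn
        (Y * z).continuous_fn.continuousOn
    · exact ((Y.continuous_fn.mul z.continuous_fn).const_mul l).intervalIntegrable 0 1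
  simp only [pencil, h1, hparts, h2, hQ, hY0, hY1]
  linear_combination hb1 * z.fn 1 - hb0 * z.fn 0

lemma absolutelyContinuousOnInterval_congr {f g : ℝ → ℝ} {a b : ℝ}
    (hf : AbsolutelyContinuousOnInterval f a b) (hfg : EqOn g f (uIcc a b)) :
    AbsolutelyContinuousOnInterval g a b := by
  rw [absolutelyContinuousOnInterval_iff] at hf ⊢
  intro ε hε
  obtain ⟨δ, hδ, h⟩ := hf ε hε
  refine ⟨δ, hδ, fun E hE hlen => ?_⟩
  rw [Finset.sum_congr rfl fun i hi =>
    show dist (g (E.2 i).1) (g (E.2 i).2) = dist (f (E.2 i).1) (f (E.2 i).2) by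
      rw [hfg (hE.1 i hi).1, hfg (hE.1 i hi).2]]
  exact h E hE hlen

/-- The positive function `exp (∫₀ˣ w)` is an eigenfunction for the boundary conditions that `w`
satisfies at the end points. -/
lemma IsRiccati.isEigenvalue {q w : ℝ → ℝ} {lam : ℝ} (h : IsRiccati q lam 0 1 w) :
    IsEigenvalue q (w 0) (-w 1) lam := by
  have hwc : ContinuousOn w (Icc 0 1) := by
    simpa [uIcc_of_le zero_le_one] using h.1.continuousOn
  -- `w` is only known on `[0,1]`; a globally continuous extension makes `exp (∫ W)` of class `C¹`.
  set W : ℝ → ℝ := IccExtend zero_le_one ((Icc (0 : ℝ) 1).domRestrict w) with hW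
  have hWc : Continuous W := hwc.domRestrict.Icc_extend'
  have hWw : EqOn W w (Icc 0 1) := fun x hx => by
    simp only [hW, IccExtend_of_mem _ _ hx]
    rfl
  set y : ℝ → ℝ := fun x => Real.exp (∫ t in (0 : ℝ)..x, W t) with hy
  have hd : ∀ x, HasDerivAt y (y x * W x) x := fun x =>
    (hWc.integral_hasStrictDerivAt 0 x).hasDerivAt.exp
  have hyc : Continuous y := continuous_iff_continuousAt.2 fun x => (hd x).continuousAt
  have hud := uniqueDiffOn_Icc (zero_lt_one (α := ℝ))
  have hdw : EqOn (derivWithin y (Icc 0 1)) (y * w) (Icc 0 1) := fun x hx => by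
    rw [(hd x).hasDerivWithinAt.derivWithin (hud x hx), hWw hx]
    rfl
  have hy1 : ContDiff ℝ 1 y := by
    rw [contDiff_one_iff_deriv]
    refine ⟨fun x => (hd x).differentiableAt, ?_⟩
    rw [show deriv y = fun x => y x * W x from funext fun x => (hd x).deriv]
    exact hyc.mul hWc
  have hyac : AbsolutelyContinuousOnInterval (y * w) 0 1 :=
    hy1.contDiffOn.absolutelyContinuousOnInterval.mul h.1
  refine ⟨y, ⟨hy1.contDiffOn, ?_⟩, ⟨0, by simp, (Real.exp_pos _).ne'⟩, ?_, ?_, ?_⟩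
  · refine absolutelyContinuousOnInterval_congr hyac ?_
    rwa [uIcc_of_le zero_le_one]
  · refine ae_leb_iff.2 ?_
    filter_upwards [h.2] with x hx hm
    have hn : Icc (0 : ℝ) 1 ∈ nhds x := Icc_mem_nhds hm.1 hm.2
    rw [derivWithin_of_mem_nhds hn, (hdw.eventuallyEq_of_mem hn).deriv_eq,
      ((hd x).mul (hx hm)).deriv, hWw (Ioo_subset_Icc_self hm)]
    ring
  · rw [hdw (by simp)]
    simp [mul_comm]
  · rw [hdw (by simp)]
    simp [mul_comm]

lemma IsRiccati.le_form {q w : ℝ → ℝ} {lam : ℝ} {Q : Wm1} (h : IsRiccati q lam 0 1 w)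
    (hq : Integrable q leb) (hQ : ∀ z : W21, Q z = ∫ x in (0 : ℝ)..1, q x * z.fn x) (y : W21) :
    lam * (∫ x in (0 : ℝ)..1, y.fn x ^ 2) ≤
      (∫ x in (0 : ℝ)..1, deriv y.fn x ^ 2) + Q (y * y) + w 0 * y.fn 0 ^ 2
        + -w 1 * y.fn 1 ^ 2 := by
  have h1 := h.le_energy hq le_rfl zero_le_one le_rfl y
  have h2 : Q (y * y) = ∫ x in (0 : ℝ)..1, q x * y.fn x ^ 2 := by
    simp only [hQ, W21.fn_mul, Pi.mul_apply, sq]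
  linarith

/-- The eigenvalue of a positive eigenfunction is the least one: the logarithmic derivative turns
Picone's inequality into the optimal lower bound for the energy form. -/
lemma IsRiccati.isMinEigenvalue {q w : ℝ → ℝ} {lam : ℝ} {Q : Wm1} (h : IsRiccati q lam 0 1 w)
    (hq : Integrable q leb) (hQ : ∀ z : W21, Q z = ∫ x in (0 : ℝ)..1, q x * z.fn x) :
    IsMinEigenvalue q (w 0) (-w 1) lam :=
  ⟨h.isEigenvalue, fun _ hl =>
    le_of_isPencilEigenvalue (h.le_form hq hQ) (hl.isPencilEigenvalue hq hQ)⟩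

lemma IsRiccati.isMinPencilEigenvalue {q w : ℝ → ℝ} {lam : ℝ} {Q : Wm1}
    (h : IsRiccati q lam 0 1 w) (hq : Integrable q leb)
    (hQ : ∀ z : W21, Q z = ∫ x in (0 : ℝ)..1, q x * z.fn x) :
    IsMinPencilEigenvalue Q (w 0) (-w 1) lam :=
  ⟨h.isEigenvalue.isPencilEigenvalue hq hQ, fun _ hl =>
    le_of_isPencilEigenvalue (h.le_form hq hQ) hl⟩

/-! ### The lower bound for the energy form -/

open Real in
lemma hasDerivAt_riccatiTan {ν φ x : ℝ} (hx : ν * x - φ ∈ Ioo (-(π / 2)) (π / 2)) :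
    HasDerivAt (fun x => -ν * tan (ν * x - φ))
      (-ν ^ 2 - (-ν * tan (ν * x - φ)) ^ 2) x := by
  have hcos : cos (ν * x - φ) ≠ 0 := (cos_pos_of_mem_Ioo hx).ne'
  have h1 : HasDerivAt (fun x => ν * x - φ) ν x := by
    simpa using ((hasDerivAt_id x).const_mul ν).sub_const φ
  have h2 := ((hasDerivAt_tan hcos).comp x h1).const_mul (-ν)
  refine h2.congr_deriv ?_
  rw [tan_eq_sin_div_cos]
  field_simp
  linear_combination ν ^ 2 * (sin_sq_add_cos_sq (ν * x - φ))

open Real in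
lemma contDiffOn_riccatiTan {ν φ c d : ℝ}
    (h : ∀ x ∈ Icc c d, ν * x - φ ∈ Ioo (-(π / 2)) (π / 2)) :
    ContDiffOn ℝ 1 (fun x => -ν * tan (ν * x - φ)) (Icc c d) := fun x hx => by
  have hcos : cos (ν * x - φ) ≠ 0 := (cos_pos_of_mem_Ioo (h x hx)).ne'
  have h1 : ContDiffAt ℝ 1 tan (ν * x - φ) := contDiffAt_tan.2 hcos
  have h2 : ContDiffAt ℝ 1 (fun x => ν * x - φ) x := by fun_prop
  exact (contDiffAt_const.mul (ContDiffAt.comp (g := tan) x h1 h2)).contDiffWithinAt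

open Real in
lemma isRiccati_tan {ν φ c d : ℝ} (hcd : c ≤ d)
    (h : ∀ x ∈ Icc c d, ν * x - φ ∈ Ioo (-(π / 2)) (π / 2)) :
    IsRiccati (fun _ => 0) (ν ^ 2) c d (fun x => -ν * tan (ν * x - φ)) := by
  refine ⟨ContDiffOn.absolutelyContinuousOnInterval ?_,
    Filter.Eventually.of_forall fun x hx => ?_⟩
  · rw [uIcc_of_le hcd]
    exact contDiffOn_riccatiTan h
  · simpa using hasDerivAt_riccatiTan (h x (Ioo_subset_Icc_self hx))

open Real in
/-- The number `ω²` is the least eigenvalue of `-y'' = lam y`, `y'(0) = a y(0)`,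
`y'(1) = -(b + 1) y(1)`: this is the condition that the phase `ω x - arctan (a / ω)` of the cosine
reaches `arctan ((b + 1) / ω)` at `x = 1`. -/
lemma exists_frequency {a b : ℝ} (ha : 0 ≤ a) (hb : 0 ≤ b) :
    ∃ ω > 0, arctan (a / ω) + arctan ((b + 1) / ω) = ω := by
  have hcont : ContinuousOn (fun ω : ℝ => arctan (a / ω) + arctan ((b + 1) / ω) - ω)
      (Icc (1 / 2) π) := by
    have h0 : ∀ x ∈ Icc (1 / 2 : ℝ) π, x ≠ 0 := fun x hx => by
      have := hx.1
      positivity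
    exact ((continuous_arctan.comp_continuousOn (continuousOn_const.div continuousOn_id h0)).add
      (continuous_arctan.comp_continuousOn (continuousOn_const.div continuousOn_id h0))).sub
      continuousOn_id
  have hpi := pi_gt_three
  obtain ⟨ω, hω, h⟩ := intermediate_value_Icc' (by linarith) hcont (show (0 : ℝ) ∈ _ from by
    constructor
    · have h1 := arctan_lt_pi_div_two (a / π)
      have h2 := arctan_lt_pi_div_two ((b + 1) / π)
      linarith
    · have h1 : 0 ≤ arctan (a / (1 / 2)) := arctan_nonneg.2 (by positivity)
      have h2 : arctan 1 ≤ arctan ((b + 1) / (1 / 2)) := arctan_strictMono.monotone (by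
        rw [le_div_iff₀ (by norm_num)]
        linarith)
      rw [arctan_one] at h2
      linarith)
  exact ⟨ω, by linarith [hω.1], by simpa [sub_eq_zero] using h⟩

open Real in
/-- With `d = β - β'`, the difference is `2 sin d / (cos d + cos (2 θ - d))`, which is largest where
`|2 θ - d|` is. The hypothesis `α ≤ β'` says that on `[-α, β]` this happens at `θ = β`. -/
lemma tan_sub_tan_le {α β β' θ : ℝ} (hα : 0 ≤ α) (hαβ : α ≤ β') (hβ : β' ≤ β) (hβ2 : β < π / 2)
    (h1 : -α ≤ θ) (h2 : θ ≤ β) :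
    tan θ - tan (θ - (β - β')) ≤ tan β - tan β' := by
  have key : ∀ x ∈ Ioo (-(π / 2)) (π / 2), ∀ y ∈ Ioo (-(π / 2)) (π / 2),
      tan x - tan y = sin (x - y) / (cos x * cos y) := fun x hx y hy => by
    have hcx := (cos_pos_of_mem_Ioo hx).ne'
    have hcy := (cos_pos_of_mem_Ioo hy).ne'
    rw [tan_eq_sin_div_cos, tan_eq_sin_div_cos, sin_sub]
    field_simp
  have mβ : β ∈ Ioo (-(π / 2)) (π / 2) := ⟨by linarith, hβ2⟩
  have mβ' : β' ∈ Ioo (-(π / 2)) (π / 2) := ⟨by linarith, by linarith⟩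
  have mθ : θ ∈ Ioo (-(π / 2)) (π / 2) := ⟨by linarith, by linarith⟩
  have mθ' : θ - (β - β') ∈ Ioo (-(π / 2)) (π / 2) := ⟨by linarith, by linarith⟩
  rw [key _ mθ _ mθ', key _ mβ _ mβ', sub_sub_cancel]
  have hsin : 0 ≤ sin (β - β') := sin_nonneg_of_nonneg_of_le_pi (by linarith) (by linarith)
  have hpos : 0 < cos β * cos β' := mul_pos (cos_pos_of_mem_Ioo mβ) (cos_pos_of_mem_Ioo mβ')
  refine div_le_div_of_nonneg_left hsin hpos ?_
  have hcos : cos (β + β') ≤ cos (2 * θ - (β - β')) := by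
    rw [← cos_abs (2 * θ - (β - β'))]
    exact cos_le_cos_of_nonneg_of_le_pi (abs_nonneg _) (by linarith)
      (abs_le.2 ⟨by linarith, by linarith⟩)
  have e1 := cos_add β β'
  have e2 := cos_sub β β'
  have e3 := cos_add θ (θ - (β - β'))
  have e4 := cos_sub θ (θ - (β - β'))
  rw [show θ + (θ - (β - β')) = 2 * θ - (β - β') by ring] at e3
  rw [sub_sub_cancel] at e4
  linarith

open Real in
/-- The energy form of the potential `δ_c` is bounded below by the least eigenvalue for `δ_1`.
Picone's inequality is applied on `[0, c]` to the solution of `w' = -ω² - w²` with `w(0) = a`, and on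
`[c, 1]` to the one with `w(1) = -b`. The resulting term at `c` is the difference of the two solutions
times `y(c)²`. The difference equals `1` at `c = 1`, and `a ≤ b` makes that its maximum. -/
lemma frequency_sq_le {a b ω : ℝ} (ha : 0 ≤ a) (hab : a ≤ b) (hω : 0 < ω)
    (h : arctan (a / ω) + arctan ((b + 1) / ω) = ω) (y : W21) {c : ℝ} (hc : c ∈ Icc (0 : ℝ) 1) :
    ω ^ 2 * (∫ x in (0 : ℝ)..1, y.fn x ^ 2) ≤
      (∫ x in (0 : ℝ)..1, deriv y.fn x ^ 2) + y.fn c ^ 2 + a * y.fn 0 ^ 2 + b * y.fn 1 ^ 2 := by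
  set α := arctan (a / ω) with hα
  set β := arctan ((b + 1) / ω) with hβ
  set β' := arctan (b / ω) with hβ'
  have hα0 : 0 ≤ α := arctan_nonneg.2 (by positivity)
  have hαβ : α ≤ β' := arctan_strictMono.monotone (by gcongr)
  have hββ : β' ≤ β := arctan_strictMono.monotone (by gcongr; linarith)
  have hβ2 : β < π / 2 := arctan_lt_pi_div_two _
  have hpi := pi_pos
  have m1 : ∀ x ∈ Icc (0 : ℝ) c, ω * x - α ∈ Ioo (-(π / 2)) (π / 2) := fun x hx => by
    have h1 : 0 ≤ ω * x := mul_nonneg hω.le hx.1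
    have h2 : ω * x ≤ ω := mul_le_of_le_one_right hω.le (hx.2.trans hc.2)
    constructor <;> linarith
  have m2 : ∀ x ∈ Icc c 1, ω * x - (α + (β - β')) ∈ Ioo (-(π / 2)) (π / 2) := fun x hx => by
    have h1 : 0 ≤ ω * x := mul_nonneg hω.le (hc.1.trans hx.1)
    have h2 : ω * x ≤ ω := mul_le_of_le_one_right hω.le hx.2
    constructor <;> linarith
  have b1 := (isRiccati_tan hc.1 m1).le_energy (integrable_zero _ _ _) le_rfl hc.1 hc.2 y
  have b2 := (isRiccati_tan hc.2 m2).le_energy (integrable_zero _ _ _) hc.1 hc.2 le_rfl y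
  have hjump : ω * (tan (ω * c - α) - tan (ω * c - (α + (β - β')))) ≤ 1 := by
    have h1 : 0 ≤ ω * c := mul_nonneg hω.le hc.1
    have h2 : ω * c ≤ ω := mul_le_of_le_one_right hω.le hc.2
    have h3 := tan_sub_tan_le hα0 hαβ hββ hβ2 (θ := ω * c - α) (by linarith) (by linarith)
    rw [sub_sub] at h3
    calc _ ≤ ω * (tan β - tan β') := by gcongr
      _ = 1 := by
        rw [hβ, hβ', tan_arctan, tan_arctan]
        field_simp
        ring
  have e0 : -ω * tan (ω * 0 - α) = a := by
    rw [mul_zero, zero_sub, tan_neg, hα, tan_arctan]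
    field_simp
  have e1 : -ω * tan (ω * 1 - (α + (β - β'))) = -b := by
    rw [show ω * 1 - (α + (β - β')) = β' by linarith, hβ', tan_arctan]
    field_simp
  simp only [zero_mul, intervalIntegral.integral_zero] at b1 b2
  rw [e0] at b1
  rw [e1] at b2
  have hi1 : ∀ c d, IntervalIntegrable (fun x => y.fn x ^ 2) volume c d := fun c d =>
    (y.continuous_fn.pow 2).intervalIntegrable c d
  rw [← intervalIntegral.integral_add_adjacent_intervals (hi1 0 c) (hi1 c 1),
    ← intervalIntegral.integral_add_adjacent_intervals
      (intervalIntegrable_of_leb y.memLp_deriv.integrable_sq le_rfl hc.1 hc.2)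
      (intervalIntegrable_of_leb y.memLp_deriv.integrable_sq hc.1 hc.2 le_rfl)]
  nlinarith [mul_le_mul_of_nonneg_right hjump (sq_nonneg (y.fn c))]

lemma ofL1_apply (q : Lp ℝ 1 leb) (z : W21) :
    ofL1 q z = ∫ x in (0 : ℝ)..1, q x * z.fn x := by
  rw [← integral_leb]
  rfl

/-- Averaging the bounds for `δ_c` over `c` with the weight `q` gives the bound for `q ∈ A_1`;
it is a closed condition on the potential. -/
lemma le_form_of_mem_Gamma1 {a b lam : ℝ} (h : ∀ y : W21, ∀ c ∈ Icc (0 : ℝ) 1,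
      lam * (∫ x in (0 : ℝ)..1, y.fn x ^ 2) ≤
      (∫ x in (0 : ℝ)..1, deriv y.fn x ^ 2) + y.fn c ^ 2 + a * y.fn 0 ^ 2 + b * y.fn 1 ^ 2)
    {Q : Wm1} (hQ : Q ∈ Gamma1) (y : W21) :
    lam * (∫ x in (0 : ℝ)..1, y.fn x ^ 2) ≤
      (∫ x in (0 : ℝ)..1, deriv y.fn x ^ 2) + Q (y * y) + a * y.fn 0 ^ 2 + b * y.fn 1 ^ 2 := by
  have hclosed : IsClosed {Q : Wm1 | lam * (∫ x in (0 : ℝ)..1, y.fn x ^ 2) ≤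
      (∫ x in (0 : ℝ)..1, deriv y.fn x ^ 2) + Q (y * y) + a * y.fn 0 ^ 2 + b * y.fn 1 ^ 2} := by
    refine isClosed_le continuous_const ?_
    fun_prop
  refine closure_minimal ?_ hclosed hQ
  rintro _ ⟨q, ⟨hq0, hq1⟩, rfl⟩
  set K := lam * (∫ x in (0 : ℝ)..1, y.fn x ^ 2) - ((∫ x in (0 : ℝ)..1, deriv y.fn x ^ 2)
    + a * y.fn 0 ^ 2 + b * y.fn 1 ^ 2) with hK
  have h1 : ∫ x, q x * K ∂leb ≤ ∫ x, q x * (y * y).fn x ∂leb := by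
    refine integral_mono_ae ((L1.integrable_coeFn q).mul_const K) (integrable_mul_fn q _) ?_
    filter_upwards [hq0, ae_restrict_mem measurableSet_Icc] with x hx hm
    refine mul_le_mul_of_nonneg_left ?_ hx
    have := h y x hm
    simp only [W21.fn_mul, Pi.mul_apply, ← sq]
    linarith
  rw [integral_mul_const, integral_leb, hq1] at h1
  have h2 : ofL1 q (y * y) = ∫ x, q x * (y * y).fn x ∂leb := rfl
  rw [mem_ofPred_eq]
  linarith

/-! ### The Dirac function as a limit of summable potentials -/

/-- Hölder continuity with exponent `1/2` of the functions in `W_2^1[0,1]`. -/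
lemma W21.abs_sub_le (z : W21) {c d ε : ℝ} (hc : 0 ≤ c) (hcd : c ≤ d) (hd : d ≤ 1) (hε : 0 < ε)
    (h : d - c ≤ ε ^ 2) : |z.fn d - z.fn c| ≤ ε * ‖z‖ := by
  rcases eq_or_ne z 0 with rfl | hz
  · have h0 : ∀ x, (0 : W21).fn x = 0 := fun _ => rfl
    simp [h0]
  have hN : 0 < ‖z‖ := norm_pos_iff.2 hz
  have hac : AbsolutelyContinuousOnInterval z.fn c d := by
    refine z.ac.mono ?_
    rw [uIcc_of_le hcd, uIcc_of_le zero_le_one]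
    exact Icc_subset_Icc hc hd
  have hi := intervalIntegrable_of_leb z.memLp_deriv.integrable_sq hc hcd hd
  have hsq : ∫ x in c..d, deriv z.fn x ^ 2 ≤ ‖z‖ ^ 2 := by
    rw [W21.norm_sq]
    refine (intervalIntegral.integral_mono_interval (c := 0) (d := 1) hc hcd hd
      (Filter.Eventually.of_forall fun x => sq_nonneg _)
      (intervalIntegrable_of_leb z.memLp_deriv.integrable_sq le_rfl zero_le_one le_rfl)).trans ?_
    refine intervalIntegral.integral_mono_on zero_le_one
      (intervalIntegrable_of_leb z.memLp_deriv.integrable_sq le_rfl zero_le_one le_rfl)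
      (intervalIntegrable_of_leb (z.memLp_fn.integrable_sq.add z.memLp_deriv.integrable_sq)
        le_rfl zero_le_one le_rfl) fun x _ => ?_
    linarith [sq_nonneg (z.fn x)]
  rw [← hac.integral_deriv_eq_sub]
  -- Young's inequality, with the weight that is optimal for `d - c = ε²` and `∫ z'² = ‖z‖²`.
  have hpt : ∀ x, |deriv z.fn x| ≤ (2 * ‖z‖ / ε)⁻¹ * deriv z.fn x ^ 2 + ‖z‖ / (2 * ε) := by
    intro x
    have : (2 * ‖z‖ / ε)⁻¹ * deriv z.fn x ^ 2 + ‖z‖ / (2 * ε) - |deriv z.fn x|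
        = (ε * |deriv z.fn x| - ‖z‖) ^ 2 / (2 * ‖z‖ * ε) := by
      rw [← sq_abs (deriv z.fn x)]
      field_simp
      ring
    have h2 : 0 ≤ (ε * |deriv z.fn x| - ‖z‖) ^ 2 / (2 * ‖z‖ * ε) := by positivity
    linarith
  calc |∫ x in c..d, deriv z.fn x| ≤ ∫ x in c..d, |deriv z.fn x| :=
        intervalIntegral.abs_integral_le_integral_abs hcd
    _ ≤ ∫ x in c..d, ((2 * ‖z‖ / ε)⁻¹ * deriv z.fn x ^ 2 + ‖z‖ / (2 * ε)) :=
        intervalIntegral.integral_mono_on hcd hac.intervalIntegrable_deriv.abs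
          ((hi.const_mul _).add intervalIntegrable_const) fun x _ => hpt x
    _ = (2 * ‖z‖ / ε)⁻¹ * (∫ x in c..d, deriv z.fn x ^ 2) + (d - c) * (‖z‖ / (2 * ε)) := by
        rw [intervalIntegral.integral_add (hi.const_mul _) intervalIntegrable_const,
          intervalIntegral.integral_const_mul, intervalIntegral.integral_const, smul_eq_mul]
    _ ≤ (2 * ‖z‖ / ε)⁻¹ * ‖z‖ ^ 2 + ε ^ 2 * (‖z‖ / (2 * ε)) := by gcongr
    _ = ε * ‖z‖ := by
        field_simp
        ring

lemma delta_one_apply (z : W21) : delta 1 z = z.fn 1 := rfl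

lemma toL1_mem_A1 {g : ℝ → ℝ} (hg : Integrable g leb) (hg0 : ∀ᵐ x ∂leb, 0 ≤ g x)
    (hg1 : ∫ x in (0 : ℝ)..1, g x = 1) : hg.toL1 g ∈ A1 := by
  refine ⟨?_, ?_⟩
  · filter_upwards [hg.coeFn_toL1, hg0] with x hx h0
    rwa [hx]
  · rw [← integral_leb, integral_congr_ae hg.coeFn_toL1, integral_leb, hg1]

lemma ofL1_toL1_apply {g : ℝ → ℝ} (hg : Integrable g leb) (z : W21) :
    ofL1 (hg.toL1 g) z = ∫ x, g x * z.fn x ∂leb := by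
  refine integral_congr_ae ?_
  filter_upwards [hg.coeFn_toL1] with x hx
  rw [hx]

/-- A probability density concentrated near `1` is close to `δ_1` in `W_2^{-1}[0,1]`. -/
lemma norm_ofL1_sub_delta_one_le {g : ℝ → ℝ} {ε : ℝ} (hε : 0 < ε) (hg : Integrable g leb)
    (hg0 : ∀ᵐ x ∂leb, 0 ≤ g x) (hg1 : ∫ x, g x ∂leb = 1)
    (hsupp : ∀ᵐ x ∂leb, g x ≠ 0 → 1 - ε ^ 2 ≤ x) : ‖ofL1 (hg.toL1 g) - delta 1‖ ≤ ε := by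
  refine ContinuousLinearMap.opNorm_le_bound _ hε.le fun z => ?_
  have h1 : (ofL1 (hg.toL1 g) - delta 1) z = ∫ x, g x * (z.fn x - z.fn 1) ∂leb := by
    simp only [mul_sub]
    rw [integral_sub, integral_mul_const, hg1, one_mul, ← ofL1_toL1_apply hg]
    · rfl
    · exact hg.mul_bdd (c := 2 * ‖z‖) z.continuous_fn.aestronglyMeasurable
        (Filter.Eventually.of_forall fun x => z.abs_fn_le x)
    · exact hg.mul_const _
  rw [h1]
  refine (norm_integral_le_of_norm_le (hg.mul_const (ε * ‖z‖)) ?_).trans (le_of_eq ?_)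
  · filter_upwards [hg0, hsupp, ae_restrict_mem measurableSet_Icc] with x h0 hx hm
    rcases eq_or_ne (g x) 0 with hgx | hgx
    · simp [hgx]
    rw [norm_mul, Real.norm_of_nonneg h0, Real.norm_eq_abs, abs_sub_comm]
    gcongr
    exact z.abs_sub_le hm.1 hm.2 le_rfl hε (by linarith [hx hgx])
  · rw [integral_mul_const, hg1, one_mul]

lemma delta_one_mem_Gamma1 : delta 1 ∈ Gamma1 := by
  refine Metric.mem_closure_iff.2 fun ε hε => ?_
  set δ := min (ε / 2) 1 with hδ
  have hδ0 : 0 < δ := by positivity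
  have hδ1 : δ ^ 2 ≤ 1 := pow_le_one₀ hδ0.le (min_le_right _ _)
  set g : ℝ → ℝ := (Icc (1 - δ ^ 2) 1).indicator fun _ => (δ ^ 2)⁻¹ with hg
  have hgi : Integrable g leb := (integrable_const _).indicator measurableSet_Icc
  have hg0 : ∀ x, 0 ≤ g x := indicator_nonneg fun _ _ => by positivity
  have hg1 : ∫ x, g x ∂leb = 1 := by
    rw [hg, integral_indicator measurableSet_Icc, Measure.restrict_restrict measurableSet_Icc,
      inter_eq_left.2 (Icc_subset_Icc (by linarith) le_rfl), setIntegral_const]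
    simp [hδ0.ne', hδ0.le]
  refine ⟨_, ⟨_, toL1_mem_A1 hgi (Filter.Eventually.of_forall hg0) (by rw [← integral_leb, hg1]),
    rfl⟩, ?_⟩
  rw [dist_comm, dist_eq_norm]
  refine (norm_ofL1_sub_delta_one_le hδ0 hgi (Filter.Eventually.of_forall hg0) hg1
    (Filter.Eventually.of_forall fun x hx => ?_)).trans_lt
    ((min_le_left _ _).trans_lt (half_lt_self hε))
  exact (mem_of_indicator_ne_zero hx).1

/-! ### Summable potentials with eigenvalues close to the infimum -/

lemma IsRiccati.congr {q q' w : ℝ → ℝ} {lam : ℝ} (h : IsRiccati q lam 0 1 w)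
    (hq : q' =ᵐ[leb] q) : IsRiccati q' lam 0 1 w := by
  refine ⟨h.1, ?_⟩
  filter_upwards [h.2, ae_leb_iff.1 hq] with x hx hqx hm
  rw [hqx hm]
  exact hx hm

open Real in
/-- The potential is built from its Riccati solution `w`: on `[0, p]` it is `-ν tan (ν x - φ)`,
which solves the equation with `q = 0`, and on `[p, 1]` it is linear with slope `s`, from `-T` up to
`-b`. The hypothesis `hG` says that `q = w' + ν² + w²` on `[p, 1]` has integral `1`. -/
lemma exists_mem_A1_isMinEigenvalue {ν φ b p T s : ℝ} (hp : p ∈ Ico (0 : ℝ) 1)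
    (h : ∀ x ∈ Icc (0 : ℝ) p, ν * x - φ ∈ Ioo (-(π / 2)) (π / 2)) (hT : ν * tan (ν * p - φ) = T)
    (hs : 0 ≤ s) (hsT : s * (1 - p) = T - b)
    (hG : T - b + (1 - p) * (ν ^ 2 + (T ^ 2 + T * b + b ^ 2) / 3) = 1) :
    ∃ q ∈ A1, IsMinEigenvalue q (ν * tan φ) b (ν ^ 2) := by
  set w₁ : ℝ → ℝ := fun x => -ν * tan (ν * x - φ) with hw₁
  set w₂ : ℝ → ℝ := fun x => -T + s * (x - p) with hw₂
  -- The two pieces glued in a form that is visibly Lipschitz.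
  set w : ℝ → ℝ := fun x => w₁ (min x p) + s * max (x - p) 0 with hw
  have hw₁p : w₁ p = -T := by rw [← hT]; simp [hw₁]
  have hwl : ∀ x ≤ p, w x = w₁ x := fun x hx => by
    simp [hw, min_eq_left hx, max_eq_right (sub_nonpos.2 hx)]
  have hwr : ∀ x, p ≤ x → w x = w₂ x := fun x hx => by
    simp [hw, hw₂, min_eq_right hx, max_eq_left (sub_nonneg.2 hx), hw₁p]
  set g : ℝ → ℝ := (Ioi p).indicator fun x => s + w₂ x ^ 2 + ν ^ 2 with hg
  have hcont : Continuous fun x => s + w₂ x ^ 2 + ν ^ 2 := by fun_prop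
  have hgi : Integrable g leb := hcont.integrableOn_Icc.indicator measurableSet_Ioi
  have hg0 : ∀ x, 0 ≤ g x := indicator_nonneg fun x _ => by positivity
  have hac : AbsolutelyContinuousOnInterval w 0 1 := by
    obtain ⟨K, hK⟩ := (contDiffOn_riccatiTan h).exists_lipschitzOnWith one_ne_zero
      (convex_Icc _ _) isCompact_Icc
    have h1 : LipschitzOnWith (K * 1) (w₁ ∘ fun x => min x p) (uIcc 0 1) :=
      hK.comp (LipschitzWith.id.min_const p).lipschitzOnWith fun x hx => by
        rw [uIcc_of_le zero_le_one] at hx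
        exact ⟨le_min hx.1 hp.1, min_le_right _ _⟩
    have h2 : LipschitzWith 1 fun x : ℝ => max (x - p) 0 :=
      (LipschitzWith.of_le_add fun x y => by
        rw [Real.dist_eq]; linarith [le_abs_self (x - y)]).max_const 0
    exact h1.absolutelyContinuousOnInterval.add
      (h2.lipschitzOnWith.absolutelyContinuousOnInterval.const_mul s)
  have hric : IsRiccati g (ν ^ 2) 0 1 w := by
    refine ⟨hac, ?_⟩
    filter_upwards [Measure.ae_ne volume p] with x hxp hm
    rcases lt_or_gt_of_ne hxp with hx | hx
    · have hd := hasDerivAt_riccatiTan (h x ⟨hm.1.le, hx.le⟩)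
      have hgx : g x = 0 := indicator_of_notMem (by simpa using hx.le) _
      rw [hgx, zero_sub, hwl x hx.le]
      exact hd.congr_of_eventuallyEq ((eventually_lt_nhds hx).mono fun t ht => hwl t ht.le)
    · have hd : HasDerivAt w₂ s x :=
        ((((hasDerivAt_id x).sub_const p).const_mul s).const_add (-T)).congr_deriv (mul_one s)
      have hgx : g x = s + w₂ x ^ 2 + ν ^ 2 := indicator_of_mem (by simpa using hx) _
      rw [hgx, hwr x hx.le]
      refine (hd.congr_of_eventuallyEq
        ((eventually_gt_nhds hx).mono fun t ht => hwr t ht.le)).congr_deriv ?_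
      ring
  have hg1 : ∫ x in (0 : ℝ)..1, g x = 1 := by
    rw [← intervalIntegral.integral_add_adjacent_intervals
      (intervalIntegrable_of_leb hgi le_rfl hp.1 hp.2.le)
      (intervalIntegrable_of_leb hgi hp.1 hp.2.le le_rfl)]
    have e1 : ∫ x in (0 : ℝ)..p, g x = 0 := by
      rw [intervalIntegral.integral_of_le hp.1]
      refine setIntegral_eq_zero_of_forall_eq_zero fun x hx => ?_
      exact indicator_of_notMem (by simpa using hx.2) _
    have e2 : ∫ x in p..1, g x = ∫ x in p..1, (s + w₂ x ^ 2 + ν ^ 2) := by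
      rw [intervalIntegral.integral_of_le hp.2.le, intervalIntegral.integral_of_le hp.2.le]
      exact setIntegral_congr_fun measurableSet_Ioc fun x hx => indicator_of_mem hx.1 _
    have e3 : ∀ x ∈ uIcc p 1, HasDerivAt (fun x => (s + ν ^ 2 + T ^ 2) * (x - p)
        - T * s * (x - p) ^ 2 + s ^ 2 / 3 * (x - p) ^ 3) (s + w₂ x ^ 2 + ν ^ 2) x := fun x _ => by
      have h0 := (hasDerivAt_id x).sub_const p
      refine (((h0.const_mul (s + ν ^ 2 + T ^ 2)).sub ((h0.pow 2).const_mul (T * s))).add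
        ((h0.pow 3).const_mul (s ^ 2 / 3))).congr_deriv ?_
      simp only [hw₂, id, Nat.cast_ofNat]
      ring
    rw [e1, e2, intervalIntegral.integral_eq_sub_of_hasDerivAt e3 (hcont.intervalIntegrable _ _)]
    rw [show b = T - s * (1 - p) by linarith] at hG
    linear_combination hG
  refine ⟨hgi.toL1 g, toL1_mem_A1 hgi (Filter.Eventually.of_forall hg0) hg1, ?_⟩
  have hmin := (hric.congr hgi.coeFn_toL1).isMinEigenvalue (L1.integrable_coeFn _)
    (ofL1_apply (hgi.toL1 g))
  have hw0 : w 0 = ν * tan φ := by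
    rw [hwl 0 hp.1]
    simp [hw₁]
  have hw1 : -w 1 = b := by
    rw [hwr 1 hp.2.le]
    simp only [hw₂]
    linarith
  rwa [hw0, hw1] at hmin

open Real Filter Topology in
/-- For `ν` slightly above `ω`, let `G ν x` be the integral of the potential of
`exists_mem_A1_isMinEigenvalue` with linear part on `[x, 1]`. Then `G ν 1 > 1`, while `G ν p < 1` for
a suitable `p < 1`, and a value `r` with `G ν r = 1` lies in between. -/
lemma exists_frequency_lt {a b ω ε : ℝ} (ha : 0 ≤ a) (hb : 0 ≤ b) (hω : 0 < ω)
    (h : arctan (a / ω) + arctan ((b + 1) / ω) = ω) (hε : ω < ε) :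
    ∃ ν ∈ Ioo ω ε, ∃ q ∈ A1, IsMinEigenvalue q a b (ν ^ 2) := by
  set T : ℝ → ℝ → ℝ := fun ν x => ν * tan (ν * x - arctan (a / ν)) with hTdef
  set G : ℝ → ℝ → ℝ := fun ν x =>
    T ν x - b + (1 - x) * (ν ^ 2 + (T ν x ^ 2 + T ν x * b + b ^ 2) / 3) with hGdef
  have hpi := pi_pos
  have hangle : ∀ ν > 0, ν - arctan (a / ν) < π / 2 → ∀ x ∈ Icc (0 : ℝ) 1,
      ν * x - arctan (a / ν) ∈ Ioo (-(π / 2)) (π / 2) := fun ν hν hlt x hx => by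
    have h1 : 0 ≤ ν * x := mul_nonneg hν.le hx.1
    have h2 : ν * x ≤ ν := mul_le_of_le_one_right hν.le hx.2
    have h3 := arctan_lt_pi_div_two (a / ν)
    constructor <;> linarith
  have hTd : ∀ ν > 0, ν - arctan (a / ν) < π / 2 → ∀ x ∈ Icc (0 : ℝ) 1,
      HasDerivAt (T ν) (ν ^ 2 + T ν x ^ 2) x := fun ν hν hlt x hx => by
    have h1 := (hasDerivAt_riccatiTan (hangle ν hν hlt x hx)).neg
    refine (h1.congr_deriv ?_).congr_of_eventuallyEq (Eventually.of_forall fun t => ?_)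
    · simp only [hTdef]
      ring
    · simp [hTdef]
  have hTmono : ∀ ν > 0, ν - arctan (a / ν) < π / 2 → ∀ x ∈ Icc (0 : ℝ) 1, ∀ t ∈ Icc (0 : ℝ) 1,
      x < t → T ν x < T ν t := fun ν hν hlt x hx t ht hxt => by
    have h1 := hangle ν hν hlt x hx
    have h2 := hangle ν hν hlt t ht
    exact mul_lt_mul_of_pos_left (tan_lt_tan_of_lt_of_lt_pi_div_two h1.1 h2.2 (by gcongr)) hν
  have hωlt : ω - arctan (a / ω) < π / 2 := by
    have := arctan_lt_pi_div_two ((b + 1) / ω)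
    linarith
  have hTω : T ω 1 = b + 1 := by
    simp only [hTdef]
    rw [show ω * 1 - arctan (a / ω) = arctan ((b + 1) / ω) by linarith, tan_arctan]
    field_simp
  obtain ⟨p, hp, hTp⟩ : ∃ p ∈ Ioo (0 : ℝ) 1, b < T ω p := by
    have hc : Tendsto (T ω) (𝓝[<] 1) (𝓝 (T ω 1)) :=
      (hTd ω hω hωlt 1 (by simp)).continuousAt.tendsto.mono_left nhdsWithin_le_nhds
    have h1 := hc.eventually (eventually_gt_nhds (show b < T ω 1 by linarith))
    obtain ⟨p, hp1, hp2⟩ := (h1.and (Ioo_mem_nhdsLT (zero_lt_one (α := ℝ)))).exists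
    exact ⟨p, hp2, hp1⟩
  -- At `ν = ω` the increase `b + 1 - T ω p` of `T ω` over `[p, 1]` exceeds
  -- `(1 - p) (ω² + (T ω p)²)`, since `T' = ω² + T²` and `T` increases.
  have hGp : G ω p < 1 := by
    obtain ⟨c, hc, hslope⟩ := exists_hasDerivAt_eq_slope (T ω) (fun x => ω ^ 2 + T ω x ^ 2) hp.2
      (fun x hx => (hTd ω hω hωlt x ⟨hp.1.le.trans hx.1, hx.2⟩).continuousAt.continuousWithinAt)
      (fun x hx => hTd ω hω hωlt x ⟨(hp.1.trans hx.1).le, hx.2.le⟩)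
    have hlt : T ω p < T ω c := hTmono ω hω hωlt p ⟨hp.1.le, hp.2.le⟩ c
      ⟨(hp.1.trans hc.1).le, hc.2.le⟩ hc.1
    have hp1 : 0 < 1 - p := sub_pos.2 hp.2
    rw [eq_div_iff hp1.ne', hTω] at hslope
    have hsq : (T ω p ^ 2 + T ω p * b + b ^ 2) / 3 < T ω c ^ 2 := by nlinarith
    have := mul_lt_mul_of_pos_left hsq hp1
    simp only [hGdef]
    linarith
  have hαc : ContinuousAt (fun ν => arctan (a / ν)) ω :=
    continuous_arctan.continuousAt.comp (continuousAt_const.div continuousAt_id hω.ne')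
  have hTc : ContinuousAt (fun ν => T ν p) ω := by
    have hcos := (cos_pos_of_mem_Ioo (hangle ω hω hωlt p ⟨hp.1.le, hp.2.le⟩)).ne'
    exact continuousAt_id.mul (ContinuousAt.comp (f := fun ν => ν * p - arctan (a / ν))
      (g := tan) (continuousAt_tan.2 hcos) ((continuousAt_id.mul continuousAt_const).sub hαc))
  have hGc : ContinuousAt (fun ν => G ν p) ω := by
    simp only [hGdef]
    fun_prop
  obtain ⟨ν, ⟨⟨h1, h2⟩, h3⟩, hν⟩ : ∃ ν, ((ν - arctan (a / ν) < π / 2 ∧ b < T ν p) ∧ G ν p < 1) ∧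
      ν ∈ Ioo ω ε := by
    have e1 := ((continuousAt_id.sub hαc).eventually (eventually_lt_nhds hωlt))
    have e2 := hTc.eventually (eventually_gt_nhds hTp)
    have e3 := hGc.eventually (eventually_lt_nhds hGp)
    exact ((((e1.and e2).and e3).filter_mono nhdsWithin_le_nhds).and (Ioo_mem_nhdsGT hε)).exists
  have hν0 : 0 < ν := hω.trans hν.1
  have hT1 : b + 1 < T ν 1 := by
    rw [← hTω]
    have hα : arctan (a / ν) ≤ arctan (a / ω) :=
      arctan_strictMono.monotone (div_le_div_of_nonneg_left ha hω hν.1.le)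
    have hA := hangle ω hω hωlt 1 (by simp)
    have hB := hangle ν hν0 h1 1 (by simp)
    have ht := tan_lt_tan_of_lt_of_lt_pi_div_two hA.1 hB.2 (by linarith [hν.1])
    have hpos : 0 < tan (ω * 1 - arctan (a / ω)) := by
      have : 0 < ω * tan (ω * 1 - arctan (a / ω)) := by
        have := hTω
        simp only [hTdef] at this
        linarith
      exact pos_of_mul_pos_right this hω.le
    exact mul_lt_mul'' hν.1 ht hω.le hpos.le
  have hG1 : 1 < G ν 1 := by
    simp only [hGdef]
    linarith
  have hTcont : ContinuousOn (T ν) (Icc p 1) := fun x hx =>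
    (hTd ν hν0 h1 x ⟨hp.1.le.trans hx.1, hx.2⟩).continuousAt.continuousWithinAt
  have hGcont : ContinuousOn (G ν) (Icc p 1) := by
    simp only [hGdef]
    fun_prop
  obtain ⟨r, hr, hGr⟩ := intermediate_value_Ioo hp.2.le hGcont ⟨h3, hG1⟩
  have hr0 : 0 < r := hp.1.trans hr.1
  have hTr : b < T ν r := h2.trans (hTmono ν hν0 h1 p ⟨hp.1.le, hp.2.le⟩ r ⟨hr0.le, hr.2.le⟩ hr.1)
  have hr1 : 0 < 1 - r := sub_pos.2 hr.2
  obtain ⟨q, hq, hmin⟩ := exists_mem_A1_isMinEigenvalue (ν := ν) (φ := arctan (a / ν)) (b := b)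
    (s := (T ν r - b) / (1 - r)) ⟨hr0.le, hr.2⟩
    (fun x hx => hangle ν hν0 h1 x ⟨hx.1, hx.2.trans hr.2.le⟩) rfl
    (div_nonneg (by linarith) hr1.le) (div_mul_cancel₀ _ hr1.ne') hGr
  refine ⟨ν, hν, q, hq, ?_⟩
  rwa [tan_arctan, mul_div_cancel₀ _ hν0.ne'] at hmin

/-! ### The extremal problem -/

lemma isMinEigenvalue_zero_of_frequency {a b ω : ℝ} (ha : 0 ≤ a) (hω : 0 < ω)
    (h : Real.arctan (a / ω) + Real.arctan ((b + 1) / ω) = ω) :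
    IsMinEigenvalue (fun _ => 0) a (b + 1) (ω ^ 2) ∧
      IsMinPencilEigenvalue (0 : Wm1) a (b + 1) (ω ^ 2) := by
  have hα : 0 ≤ Real.arctan (a / ω) := Real.arctan_nonneg.2 (by positivity)
  have hα2 := Real.arctan_lt_pi_div_two (a / ω)
  have hβ2 := Real.arctan_lt_pi_div_two ((b + 1) / ω)
  have hric := isRiccati_tan (ν := ω) (φ := Real.arctan (a / ω)) zero_le_one fun x hx => by
    have h1 : 0 ≤ ω * x := mul_nonneg hω.le hx.1
    have h2 : ω * x ≤ ω := mul_le_of_le_one_right hω.le hx.2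
    constructor <;> linarith
  have e0 : -ω * Real.tan (ω * 0 - Real.arctan (a / ω)) = a := by
    rw [mul_zero, zero_sub, Real.tan_neg, Real.tan_arctan]
    field_simp
  have e1 : - (-ω * Real.tan (ω * 1 - Real.arctan (a / ω))) = b + 1 := by
    rw [show ω * 1 - Real.arctan (a / ω) = Real.arctan ((b + 1) / ω) by linarith,
      Real.tan_arctan]
    field_simp
  have h1 := hric.isMinEigenvalue (Q := 0) (integrable_zero _ _ _) (by simp)
  have h2 := hric.isMinPencilEigenvalue (Q := 0) (integrable_zero _ _ _) (by simp)
  rw [e0, e1] at h1 h2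
  exact ⟨h1, h2⟩

/-- The potential `δ_1` adds `1` to the coefficient of the boundary condition at the point `1`. -/
lemma isMinPencilEigenvalue_delta_one_iff {a b lam : ℝ} :
    IsMinPencilEigenvalue (delta 1) a b lam ↔ IsMinPencilEigenvalue (0 : Wm1) a (b + 1) lam := by
  have h : ∀ l y z, pencil (delta 1) a b l y z = pencil (0 : Wm1) a (b + 1) l y z := by
    intro l y z
    simp only [pencil, delta_one_apply, W21.fn_mul, Pi.mul_apply, zero_apply]
    ring
  simp only [IsMinPencilEigenvalue, IsPencilEigenvalue, h]

end SturmLiouville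

open SturmLiouville in
theorem theorem1p3p3 (k₀ k₁ : ℝ) (hk₀ : 0 ≤ k₀) (hk₁ : k₀ ≤ k₁) :
    IsGLB (SturmLiouville.LambdaA1 k₀ k₁) (SturmLiouville.m1Plus k₀ k₁) ∧
    SturmLiouville.IsMinEigenvalue (fun _ => 0) (k₀ ^ 2) (k₁ ^ 2 + 1)
      (SturmLiouville.m1Plus k₀ k₁) ∧
    SturmLiouville.delta 1 ∈ SturmLiouville.Gamma1 ∧
    SturmLiouville.IsMinPencilEigenvalue (SturmLiouville.delta 1) (k₀ ^ 2) (k₁ ^ 2)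
      (SturmLiouville.m1Plus k₀ k₁) ∧
    IsLeast (SturmLiouville.LambdaGamma1 k₀ k₁) (SturmLiouville.m1Plus k₀ k₁) := by
  have ha : 0 ≤ k₀ ^ 2 := sq_nonneg _
  have hab : k₀ ^ 2 ≤ k₁ ^ 2 := pow_le_pow_left₀ hk₀ hk₁ 2
  obtain ⟨ω, hω, hfreq⟩ := exists_frequency ha (ha.trans hab)
  obtain ⟨hmin, hpen⟩ := isMinEigenvalue_zero_of_frequency ha hω hfreq
  rw [← isMinPencilEigenvalue_delta_one_iff] at hpen
  have hform := fun Q (hQ : Q ∈ Gamma1) => le_form_of_mem_Gamma1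
    (fun y c hc => frequency_sq_le ha hab hω hfreq y hc) hQ
  have hlower : ω ^ 2 ∈ lowerBounds (LambdaA1 k₀ k₁) := by
    rintro l ⟨q, hq, hl, -⟩
    exact le_of_isPencilEigenvalue (hform _ (subset_closure (mem_image_of_mem _ hq)))
      (hl.isPencilEigenvalue (L1.integrable_coeFn q) (ofL1_apply q))
  have hglb : IsGLB (LambdaA1 k₀ k₁) (ω ^ 2) := by
    refine ⟨hlower, fun l hl => le_of_forall_gt fun m hm => ?_⟩
    obtain ⟨ν, hν, q, hq, hmin⟩ := exists_frequency_lt ha (ha.trans hab) hω hfreq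
      (Real.lt_sqrt_of_sq_lt hm)
    exact (hl ⟨q, hq, hmin⟩).trans_lt
      ((Real.lt_sqrt (hω.trans hν.1).le).1 hν.2)
  have hne : (LambdaA1 k₀ k₁).Nonempty := by
    obtain ⟨ν, -, q, hq, hmin⟩ := exists_frequency_lt ha (ha.trans hab) hω hfreq (lt_add_one ω)
    exact ⟨_, q, hq, hmin⟩
  rw [m1Plus, hglb.csInf_eq hne]
  refine ⟨hglb, hmin, delta_one_mem_Gamma1, hpen, ⟨_, delta_one_mem_Gamma1, hpen⟩, ?_⟩
  rintro l ⟨Q, hQ, hl, -⟩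
  exact le_of_isPencilEigenvalue (hform Q hQ) hl
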